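/- Let $q$ be a complex number with $|q|<1$, and write $(a;q)_n:=\prod_{j=0}^{n-1}(1-aq^j)$ and $(a;q)_\infty:=\lim_{n\to\infty}(a;q)_n=\prod_{j\ge 0}(1-aq^j)$. Let $$R(q):=\sum_{n=0}^{\infty}\frac{q^{n(n+1)/2}}{(-q;q)_n}.$$ For $m\ge 0$ let $p(m)$ be the number of non-empty partitions of $m$ in which each even part is at most twice the smallest part (so $p(0)=0$). Then all series below converge absolutely, and $$\sum_{m=0}^{\infty}p(m)\,q^m=\sum_{n=1}^{\infty}\frac{q^n}{(q^n;q)_{n+1}\,(q^{2n+1};q^2)_\infty}=-\frac12R(q)+\frac{1}{(q;q^2)_\infty}\sum_{n=0}^{\infty}\frac{q^n}{1+q^n}.$$ -/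

import Mathlib

open scoped BigOperators

/-- The finite `q`-shifted factorial `(a;q)_n = ∏_{j=0}^{n-1} (1 - a q^j)`. -/
noncomputable def qPoch (a q : ℂ) (n : ℕ) : ℂ :=
  ∏ j ∈ Finset.range n, (1 - a * q ^ j)

/-- The infinite `q`-shifted factorial `(a;q)_∞ = ∏_{j ≥ 0} (1 - a q^j)`; it is only used for
`‖q‖ < 1`, where the product converges and is the limit of `(a;q)_n`,
see `multipliable_qPochInf` and `tendsto_qPoch`. -/
noncomputable def qPochInf (a q : ℂ) : ℂ :=
  ∏' j : ℕ, (1 - a * q ^ j)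

theorem multipliable_qPochInf (a : ℂ) {q : ℂ} (hq : ‖q‖ < 1) :
    Multipliable (fun j : ℕ => 1 - a * q ^ j) := by
  have h : Summable (fun j : ℕ => ‖-(a * q ^ j)‖) := by
    simp only [norm_neg, norm_mul, norm_pow]
    exact (summable_geometric_of_lt_one (norm_nonneg q) hq).mul_left _
  simpa [sub_eq_add_neg] using multipliable_one_add_of_summable h

theorem tendsto_qPoch (a : ℂ) {q : ℂ} (hq : ‖q‖ < 1) :
    Filter.Tendsto (fun n => qPoch a q n) Filter.atTop (nhds (qPochInf a q)) :=
  (multipliable_qPochInf a hq).hasProd.tendsto_prod_nat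

/-- The `n`-th term `q^{n(n+1)/2} / (-q;q)_n` of the series `R(q)`. -/
noncomputable def ramanujanRTerm (q : ℂ) (n : ℕ) : ℂ :=
  q ^ ((n + 1).choose 2) / qPoch (-q) q n

/-- `R(q) = ∑_{n ≥ 0} q^{n(n+1)/2} / (-q;q)_n`. -/
noncomputable def ramanujanR (q : ℂ) : ℂ :=
  ∑' n : ℕ, ramanujanRTerm q n

/-- `s` is the smallest part of the partition `p`. -/
def IsSmallestPart {m : ℕ} (p : m.Partition) (s : ℕ) : Prop :=
  s ∈ p.parts ∧ ∀ i ∈ p.parts, s ≤ i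

/-- `p` has a smallest part (that is, `p` is not the empty partition of `0`), and every even part
of `p` is at most twice the smallest part. -/
def EvenPartsAtMostTwiceSmallest {m : ℕ} (p : m.Partition) : Prop :=
  ∃ s, IsSmallestPart p s ∧ ∀ i ∈ p.parts, Even i → i ≤ 2 * s

/-- The number of partitions of `m` in which each even part is at most twice the smallest part. -/
noncomputable def evenPartsCount (m : ℕ) : ℕ :=
  Nat.card {p : m.Partition // EvenPartsAtMostTwiceSmallest p}

open Filter Topology

/-! Write P = (-q;q)_∞, which is 1/(q;q²)_∞ by Euler. By `qPoch_pow_mul_qPochInf` the n-th term of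
the q-series is P · q^n / ((1 - q^n)(-q;q)_n), so everything rests on the sum L(1) of q^n / ((1 -
q^n)(-q;q)_n).

Replacing q^n by q^(mn) gives a family L(m), with a companion G(m) whose terms carry an extra
q^(n(n-1)/2). A combination of the two families and of their versions without 1 - q^n does not
depend on m; letting m → ∞ evaluates it, and m = 1 gives L(1) = G(1) + 1/2 - R(q)/(2P)
(`tsum_inv_qPoch_neg_div_one_sub_pow`). A second telescoping identifies G(1) + 1/2 with the
Lambert-type series (`hasSum_pow_div_one_add_pow`).

The partition side groups one absolutely convergent sum over multisets by smallest part and by total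
(`hasSum_evenPartsCount`). -/

lemma Filter.Tendsto.exists_norm_le {u : ℕ → ℂ} {a : ℂ} (h : Tendsto u atTop (𝓝 a)) :
    ∃ C, 0 ≤ C ∧ ∀ n, ‖u n‖ ≤ C := by
  obtain ⟨C, hC⟩ := (Metric.isBounded_range_of_tendsto u h).exists_norm_le
  exact ⟨C, (norm_nonneg _).trans (hC _ ⟨0, rfl⟩), fun n => hC _ ⟨n, rfl⟩⟩

lemma HasSum.congr_terms {ι α : Type*} [AddCommMonoid α] [TopologicalSpace α] {f g : ι → α} {a : α}
    (h : HasSum g a) (hfg : ∀ i, f i = g i) : HasSum f a :=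
  (funext hfg : f = g) ▸ h

/-! ### Bounds for q-factorials and power series evaluated at q^m. -/

section PowNorm

variable {q : ℂ}

lemma one_sub_pow_ne_zero (hq : ‖q‖ < 1) {n : ℕ} (hn : n ≠ 0) : 1 - q ^ n ≠ 0 := by
  intro h
  have : ‖q ^ n‖ < 1 := by
    rw [norm_pow]; exact pow_lt_one₀ (norm_nonneg _) hq hn
  rw [← sub_eq_zero.1 h] at this
  simp at this

lemma one_add_pow_ne_zero (hq : ‖q‖ < 1) (n : ℕ) : 1 + q ^ n ≠ 0 := by
  rcases eq_or_ne n 0 with rfl | hn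
  · norm_num
  intro h
  have : ‖q ^ n‖ < 1 := by
    rw [norm_pow]; exact pow_lt_one₀ (norm_nonneg _) hq hn
  rw [(eq_neg_of_add_eq_zero_right h)] at this
  simp at this

lemma qPoch_zero (a q : ℂ) : qPoch a q 0 = 1 := by simp [qPoch]

lemma qPoch_succ (a q : ℂ) (n : ℕ) : qPoch a q (n + 1) = qPoch a q n * (1 - a * q ^ n) := by
  simp [qPoch, Finset.prod_range_succ]

lemma qPoch_succ_left (a q : ℂ) (n : ℕ) : qPoch a q (n + 1) = (1 - a) * qPoch (a * q) q n := by
  simp [qPoch, Finset.prod_range_succ', pow_succ', mul_comm, mul_assoc]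

lemma qPoch_add (a q : ℂ) (m n : ℕ) :
    qPoch a q (m + n) = qPoch a q m * qPoch (a * q ^ m) q n := by
  simp [qPoch, Finset.prod_range_add, pow_add, mul_assoc]

lemma qPoch_ne_zero {a : ℂ} (h : ∀ j : ℕ, 1 - a * q ^ j ≠ 0) (n : ℕ) : qPoch a q n ≠ 0 :=
  Finset.prod_ne_zero_iff.2 fun j _ => h j

lemma qPochInf_ne_zero (hq : ‖q‖ < 1) {a : ℂ} (h : ∀ j : ℕ, 1 - a * q ^ j ≠ 0) :
    qPochInf a q ≠ 0 := by
  have hs : Summable (fun j : ℕ => ‖-(a * q ^ j)‖) := by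
    simp only [norm_neg, norm_mul, norm_pow]
    exact (summable_geometric_of_lt_one (norm_nonneg q) hq).mul_left _
  have := tprod_one_add_ne_zero_of_summable (f := fun j : ℕ => -(a * q ^ j))
    (by simpa [sub_eq_add_neg] using h) hs
  simpa [qPochInf, sub_eq_add_neg] using this

lemma exists_norm_inv_qPoch_le (hq : ‖q‖ < 1) {a : ℂ} (h : ∀ j : ℕ, 1 - a * q ^ j ≠ 0) :
    ∃ C, 0 ≤ C ∧ ∀ n, ‖(qPoch a q n)⁻¹‖ ≤ C :=
  ((tendsto_qPoch a hq).inv₀ (qPochInf_ne_zero hq h)).exists_norm_le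

lemma one_sub_self_mul_pow_ne_zero (hq : ‖q‖ < 1) (j : ℕ) : 1 - q * q ^ j ≠ 0 := by
  rw [← pow_succ']; exact one_sub_pow_ne_zero hq j.succ_ne_zero

lemma one_sub_neg_self_mul_pow_ne_zero (hq : ‖q‖ < 1) (j : ℕ) : 1 - -q * q ^ j ≠ 0 := by
  have := one_add_pow_ne_zero hq (j + 1)
  rw [pow_succ'] at this
  simpa using this

lemma exists_norm_inv_one_sub_pow_le (hq : ‖q‖ < 1) :
    ∃ C, 0 ≤ C ∧ ∀ n : ℕ, ‖(1 - q ^ n)⁻¹‖ ≤ C := by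
  have h : Tendsto (fun n : ℕ => (1 - q ^ n)⁻¹) atTop (𝓝 (1 - 0)⁻¹) :=
    (tendsto_const_nhds.sub (tendsto_pow_atTop_nhds_zero_of_norm_lt_one hq)).inv₀ (by simp)
  exact h.exists_norm_le

lemma summable_mul_pow_mul (hq : ‖q‖ < 1) {b : ℕ → ℂ} {C : ℝ} (hb : ∀ n, ‖b n‖ ≤ C)
    {m : ℕ} (hm : m ≠ 0) : Summable (fun n => b n * q ^ (m * n)) := by
  have hg := summable_geometric_of_lt_one (norm_nonneg q) hq
  refine Summable.of_norm_bounded (hg.mul_left C) fun n => ?_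
  rw [norm_mul, norm_pow]
  refine mul_le_mul (hb n) ?_ (by positivity) ((norm_nonneg _).trans (hb n))
  exact pow_le_pow_of_le_one (norm_nonneg _) hq.le (Nat.le_mul_of_pos_left n (by omega))

/-- Dominated convergence: only the term n = 0 survives. -/
lemma tendsto_tsum_mul_pow_mul (hq : ‖q‖ < 1) {b : ℕ → ℂ} {C : ℝ} (hb : ∀ n, ‖b n‖ ≤ C) :
    Tendsto (fun m : ℕ => ∑' n, b n * q ^ (m * n)) atTop (𝓝 (b 0)) := by
  have hg := summable_geometric_of_lt_one (norm_nonneg q) hq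
  have := tendsto_tsum_of_dominated_convergence (𝓕 := (atTop : Filter ℕ))
    (f := fun m n => b n * q ^ (m * n)) (g := fun n => if n = 0 then b 0 else 0)
    (bound := fun n => C * ‖q‖ ^ n) (hg.mul_left C) ?_ ?_
  · simpa using this
  · intro n
    rcases eq_or_ne n 0 with rfl | hn
    · simp
    · have h1 : ‖q ^ n‖ < 1 := by rw [norm_pow]; exact pow_lt_one₀ (norm_nonneg _) hq hn
      have := (tendsto_pow_atTop_nhds_zero_of_norm_lt_one h1).const_mul (b n)
      simp only [hn, if_false]
      simpa [← pow_mul, mul_comm n] using this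
  · filter_upwards [eventually_ge_atTop 1] with m hm n
    rw [norm_mul, norm_pow]
    refine mul_le_mul (hb n) ?_ (by positivity) ((norm_nonneg _).trans (hb n))
    exact pow_le_pow_of_le_one (norm_nonneg _) hq.le (Nat.le_mul_of_pos_left n (by omega))

/-- The factor 1 - q^n cancels for n ≥ 1. At n = 0 division by zero gives 0, whence the correction
`b 0`. -/
lemma tsum_div_one_sub_pow_sub (hq : ‖q‖ < 1) {b : ℕ → ℂ} {C : ℝ} (hb : ∀ n, ‖b n‖ ≤ C)
    {C' : ℝ} (hb' : ∀ n, ‖b n / (1 - q ^ n)‖ ≤ C') {m : ℕ} (hm : m ≠ 0) :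
    ∑' n, b n / (1 - q ^ n) * q ^ (m * n) - ∑' n, b n / (1 - q ^ n) * q ^ ((m + 1) * n) =
      ∑' n, b n * q ^ (m * n) - b 0 := by
  rw [← (summable_mul_pow_mul hq hb' hm).tsum_sub (summable_mul_pow_mul hq hb' m.succ_ne_zero),
    (summable_mul_pow_mul hq hb hm).tsum_eq_zero_add]
  have h := ((summable_mul_pow_mul hq hb' hm).sub (summable_mul_pow_mul hq hb' m.succ_ne_zero))
  rw [h.tsum_eq_zero_add]
  simp only [mul_zero, pow_zero, sub_self, div_zero, mul_one, zero_add, add_sub_cancel_left]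
  refine tsum_congr fun n => ?_
  have := one_sub_pow_ne_zero hq n.succ_ne_zero
  field_simp
  simp only [Nat.succ_eq_add_one]
  ring

lemma exists_norm_div_one_sub_pow_le (hq : ‖q‖ < 1) {b : ℕ → ℂ} {C : ℝ} (hb : ∀ n, ‖b n‖ ≤ C) :
    ∃ C', ∀ n, ‖b n / (1 - q ^ n)‖ ≤ C' := by
  obtain ⟨D, hD, h⟩ := exists_norm_inv_one_sub_pow_le hq
  refine ⟨C * D, fun n => ?_⟩
  rw [div_eq_mul_inv, norm_mul]
  exact mul_le_mul (hb n) (h n) (norm_nonneg _) ((norm_nonneg _).trans (hb n))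

/-- A first order recurrence for the coefficients gives a recurrence for the values at `q ^ m`. -/
lemma tsum_add_tsum_succ (hq : ‖q‖ < 1) {b d : ℕ → ℂ} {C : ℝ} (hb : ∀ n, ‖b n‖ ≤ C)
    (hbd : ∀ n, b (n + 1) * (1 + q ^ (n + 1)) = d n) {m : ℕ} (hm : m ≠ 0) :
    ∑' n, b n * q ^ (m * n) + ∑' n, b n * q ^ ((m + 1) * n) =
      2 * b 0 + q ^ m * ∑' n, d n * q ^ (m * n) := by
  have h1 := summable_mul_pow_mul hq hb hm
  have h2 := summable_mul_pow_mul hq hb m.succ_ne_zero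
  rw [← h1.tsum_add h2, (h1.add h2).tsum_eq_zero_add, ← tsum_mul_left]
  congr 1
  · simp; ring
  refine tsum_congr fun n => ?_
  rw [← hbd, Nat.succ_eq_add_one]
  ring

end PowNorm

/-! ### The duality that produces R(q). -/

section Ramanujan

variable {q : ℂ}

lemma inv_qPoch_neg_succ (hq : ‖q‖ < 1) (n : ℕ) :
    (qPoch (-q) q (n + 1))⁻¹ * (1 + q ^ (n + 1)) = (qPoch (-q) q n)⁻¹ := by
  have h1 := qPoch_ne_zero (one_sub_neg_self_mul_pow_ne_zero hq) n
  have h2 := one_add_pow_ne_zero hq (n + 1)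
  have : 1 - -q * q ^ n = 1 + q ^ (n + 1) := by ring
  rw [qPoch_succ, this]
  field_simp

/-- Telescopes: q^n/(-q;q)_n = 1/(-q;q)_{n-1} - 1/(-q;q)_n for n ≥ 1. -/
lemma tsum_inv_qPoch_neg_mul_pow (hq : ‖q‖ < 1) :
    ∑' n, (qPoch (-q) q n)⁻¹ * q ^ (1 * n) = 2 - (qPochInf (-q) q)⁻¹ := by
  obtain ⟨C, -, hC⟩ := exists_norm_inv_qPoch_le hq (one_sub_neg_self_mul_pow_ne_zero hq)
  have h := (summable_mul_pow_mul hq hC one_ne_zero).hasSum.tendsto_sum_nat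
  have hp : ∀ N, ∑ n ∈ Finset.range (N + 1), (qPoch (-q) q n)⁻¹ * q ^ (1 * n) =
      2 - (qPoch (-q) q N)⁻¹ := by
    intro N
    induction N with
    | zero => norm_num [qPoch_zero]
    | succ N ih =>
      rw [Finset.sum_range_succ, ih, ← inv_qPoch_neg_succ hq N]
      ring
  refine tendsto_nhds_unique ((tendsto_add_atTop_iff_nat 1).2 h) ?_
  simp only [hp]
  exact tendsto_const_nhds.sub ((tendsto_qPoch _ hq).inv₀
    (qPochInf_ne_zero hq (one_sub_neg_self_mul_pow_ne_zero hq)))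

lemma exists_norm_choose_inv_qPoch_le (hq : ‖q‖ < 1) :
    ∃ C, ∀ n : ℕ, ‖q ^ (n.choose 2) * (qPoch (-q) q n)⁻¹‖ ≤ C := by
  obtain ⟨C, -, hC⟩ := exists_norm_inv_qPoch_le hq (one_sub_neg_self_mul_pow_ne_zero hq)
  refine ⟨C, fun n => ?_⟩
  rw [norm_mul, norm_pow]
  exact (mul_le_of_le_one_left (norm_nonneg _) (pow_le_one₀ (norm_nonneg _) hq.le)).trans (hC n)

lemma ramanujanRTerm_eq (q : ℂ) (n : ℕ) :
    ramanujanRTerm q n = q ^ (n.choose 2) * (qPoch (-q) q n)⁻¹ * q ^ (1 * n) := by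
  rw [ramanujanRTerm, Nat.choose_succ_succ' n 1, Nat.choose_one_right, pow_add, div_eq_mul_inv]
  ring

lemma summable_ramanujanRTerm (hq : ‖q‖ < 1) : Summable (ramanujanRTerm q) := by
  obtain ⟨C, hC⟩ := exists_norm_choose_inv_qPoch_le hq
  exact (summable_mul_pow_mul hq hC one_ne_zero).congr fun n => (ramanujanRTerm_eq q n).symm

/-- The two dual sums over `1 / (-q; q)_n`. -/
lemma tsum_inv_qPoch_neg_div_one_sub_pow (hq : ‖q‖ < 1) :
    ∑' n, (qPoch (-q) q n)⁻¹ / (1 - q ^ n) * q ^ (1 * n) =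
      ∑' n : ℕ, q ^ (n.choose 2) * (qPoch (-q) q n)⁻¹ / (1 - q ^ n) * q ^ (1 * n) + 1 / 2 -
        ramanujanR q * (qPochInf (-q) q)⁻¹ / 2 := by
  obtain ⟨B, -, hB⟩ := exists_norm_inv_qPoch_le hq (one_sub_neg_self_mul_pow_ne_zero hq)
  obtain ⟨C, hC⟩ := exists_norm_choose_inv_qPoch_le hq
  obtain ⟨B', hB'⟩ := exists_norm_div_one_sub_pow_le hq hB
  obtain ⟨C', hC'⟩ := exists_norm_div_one_sub_pow_le hq hC
  set b : ℕ → ℂ := fun n => (qPoch (-q) q n)⁻¹ with hb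
  set c : ℕ → ℂ := fun n => q ^ (n.choose 2) * (qPoch (-q) q n)⁻¹ with hc
  have hb0 : b 0 = 1 := by simp [hb, qPoch_zero]
  have hc0 : c 0 = 1 := by simp [hc, qPoch_zero]
  set l : ℕ → ℂ := fun m => ∑' n, b n * q ^ (m * n)
  set g : ℕ → ℂ := fun m => ∑' n, c n * q ^ (m * n)
  set L : ℕ → ℂ := fun m => ∑' n, b n / (1 - q ^ n) * q ^ (m * n)
  set G : ℕ → ℂ := fun m => ∑' n, c n / (1 - q ^ n) * q ^ (m * n)
  have hl : ∀ m ≠ 0, l m + l (m + 1) = 2 + q ^ m * l m := fun m hm => by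
    have := tsum_add_tsum_succ hq hB (fun n => inv_qPoch_neg_succ hq n) hm
    rwa [show (qPoch (-q) q 0)⁻¹ = 1 from hb0, mul_one] at this
  have hg : ∀ m ≠ 0, g m + g (m + 1) = 2 + q ^ m * g (m + 1) := fun m hm => by
    have := tsum_add_tsum_succ hq hC (d := fun n => c n * q ^ n) (fun n => ?_) hm
    · rw [show q ^ (Nat.choose 0 2) * (qPoch (-q) q 0)⁻¹ = 1 from hc0, mul_one] at this
      refine this.trans ?_
      congr 2
      exact tsum_congr fun n => by ring
    · simp only [hc]
      rw [← inv_qPoch_neg_succ hq n, Nat.choose_succ_succ' n 1, Nat.choose_one_right]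
      ring
  have hL : ∀ m ≠ 0, L m - L (m + 1) = l m - 1 := fun m hm => by
    have := tsum_div_one_sub_pow_sub hq hB hB' hm
    rwa [show (qPoch (-q) q 0)⁻¹ = 1 from hb0] at this
  have hG : ∀ m ≠ 0, G m - G (m + 1) = g m - 1 := fun m hm => by
    have := tsum_div_one_sub_pow_sub hq hC hC' hm
    rwa [show q ^ (Nat.choose 0 2) * (qPoch (-q) q 0)⁻¹ = 1 from hc0] at this
  -- The recurrences `hl` and `hg` give l(m)g(m) - l(m+1)g(m+1) = 2(l(m) - g(m+1)), and by `hL`,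
  -- `hG` the decrease of L(m) - G(m+1) is l(m) - g(m+1).
  have hconst : ∀ m, L (m + 1) - G (m + 2) - l (m + 1) * g (m + 1) / 2 =
      L 1 - G 2 - l 1 * g 1 / 2 := by
    intro m
    induction m with
    | zero => rfl
    | succ m ih =>
      rw [← ih]
      have e1 := hl (m + 1) m.succ_ne_zero
      have e2 := hg (m + 1) m.succ_ne_zero
      have e3 := hL (m + 1) m.succ_ne_zero
      have e4 := hG (m + 2) (m + 1).succ_ne_zero
      simp only [add_assoc, Nat.reduceAdd] at e1 e2 e3 e4 ⊢
      linear_combination -e3 + e4 - g (m + 2) / 2 * e1 + l (m + 1) / 2 * e2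
  have tl : Tendsto l atTop (𝓝 1) := hb0 ▸ tendsto_tsum_mul_pow_mul hq hB
  have tg : Tendsto g atTop (𝓝 1) := hc0 ▸ tendsto_tsum_mul_pow_mul hq hC
  have tL : Tendsto L atTop (𝓝 0) := by simpa using tendsto_tsum_mul_pow_mul hq hB'
  have tG : Tendsto G atTop (𝓝 0) := by simpa using tendsto_tsum_mul_pow_mul hq hC'
  have key : L 1 - G 2 - l 1 * g 1 / 2 = 0 - 0 - 1 * 1 / 2 := by
    refine tendsto_nhds_unique (f := fun m => L (m + 1) - G (m + 2) - l (m + 1) * g (m + 1) / 2)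
      (l := atTop) ?_ ?_
    · simp only [hconst]; exact tendsto_const_nhds
    · exact (((tendsto_add_atTop_iff_nat 1).2 tL).sub ((tendsto_add_atTop_iff_nat 2).2 tG)).sub
        ((((tendsto_add_atTop_iff_nat 1).2 tl).mul ((tendsto_add_atTop_iff_nat 1).2 tg)).div_const _)
  have hl1 : l 1 = 2 - (qPochInf (-q) q)⁻¹ := tsum_inv_qPoch_neg_mul_pow hq
  have hg1 : g 1 = ramanujanR q := tsum_congr fun n => (ramanujanRTerm_eq q n).symm
  have e := hG 1 one_ne_zero
  change L 1 = G 1 + 1 / 2 - ramanujanR q * (qPochInf (-q) q)⁻¹ / 2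
  rw [hl1, hg1] at key
  rw [hg1] at e
  linear_combination key - e

end Ramanujan

/-! ### The series of q^n/(1 + q^n). -/

section Lambert

variable {q : ℂ}

/-- The shifted factorial is the quotient (-q;q)_{N+k}/(-q;q)_N, which makes the bound uniform in
both N and k. -/
lemma exists_norm_inv_qPoch_shift_le (hq : ‖q‖ < 1) :
    ∃ C, ∀ N k : ℕ, ‖(qPoch (-q * q ^ N) q k)⁻¹‖ ≤ C := by
  obtain ⟨C, -, hC⟩ := exists_norm_inv_qPoch_le hq (one_sub_neg_self_mul_pow_ne_zero hq)
  obtain ⟨D, hD, h⟩ := (tendsto_qPoch (-q) hq).exists_norm_le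
  refine ⟨D * C, fun N k => ?_⟩
  have h0 := qPoch_ne_zero (one_sub_neg_self_mul_pow_ne_zero hq) N
  have : (qPoch (-q * q ^ N) q k)⁻¹ = qPoch (-q) q N * (qPoch (-q) q (N + k))⁻¹ := by
    rw [qPoch_add, mul_inv, mul_inv_cancel_left₀ h0]
  rw [this, norm_mul]
  exact mul_le_mul (h N) (hC _) (norm_nonneg _) hD

lemma one_sub_neg_mul_pow_mul_pow_ne_zero (hq : ‖q‖ < 1) (N j : ℕ) :
    1 - -q * q ^ N * q ^ j ≠ 0 := by
  rw [mul_assoc, ← pow_add]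
  exact one_sub_neg_self_mul_pow_ne_zero hq _

lemma tsum_telescope_qPoch_neg (hq : ‖q‖ < 1) (N : ℕ) :
    HasSum (fun k : ℕ => q ^ (N * (k + 1) + (k + 2).choose 2) *
      (qPoch (-q * q ^ N) q (k + 2))⁻¹) (q ^ (N + 1) / (1 + q ^ (N + 1))) := by
  obtain ⟨C, hC⟩ := exists_norm_inv_qPoch_shift_le hq
  have hg := summable_geometric_of_lt_one (norm_nonneg q) hq
  have hle : ∀ k, k ≤ N * (k + 1) + (k + 2).choose 2 := fun k => by
    rw [Nat.choose_succ_succ' (k + 1) 1, Nat.choose_one_right]; omega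
  have hC0 : 0 ≤ C := (norm_nonneg _).trans (hC 0 0)
  have hb : ∀ k j, ‖q ^ (N * (k + 1) + (k + 2).choose 2) * (qPoch (-q * q ^ N) q j)⁻¹‖ ≤
      C * ‖q‖ ^ k := fun k j => by
    rw [norm_mul, norm_pow, mul_comm]
    exact mul_le_mul (hC N _) (pow_le_pow_of_le_one (norm_nonneg _) hq.le (hle k))
      (by positivity) hC0
  have hs := Summable.of_norm_bounded (hg.mul_left C) fun k => hb k (k + 2)
  set P : ℕ → ℂ := fun k => q ^ (N * (k + 1) + (k + 2).choose 2) *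
    (qPoch (-q * q ^ N) q (k + 1))⁻¹ with hP
  have hP0 : Tendsto P atTop (𝓝 0) :=
    squeeze_zero_norm (fun k => hb k (k + 1)) (by simpa using hg.tendsto_atTop_zero.const_mul C)
  have hdiff : ∀ k, q ^ (N * (k + 1) + (k + 2).choose 2) * (qPoch (-q * q ^ N) q (k + 2))⁻¹ =
      P k - P (k + 1) := fun k => by
    have h2 := one_sub_neg_mul_pow_mul_pow_ne_zero hq N (k + 1)
    simp only [hP]
    rw [qPoch_succ _ _ (k + 1), Nat.choose_succ_succ' (k + 2) 1, Nat.choose_one_right, mul_inv]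
    set x := (qPoch (-q * q ^ N) q (k + 1))⁻¹
    have h3 := mul_inv_cancel₀ h2
    set y := (1 - -q * q ^ N * q ^ (k + 1))⁻¹
    linear_combination (q ^ (N * (k + 1) + (k + 2).choose 2) * x) * h3
  have hval : P 0 = q ^ (N + 1) / (1 + q ^ (N + 1)) := by
    simp only [hP, zero_add, qPoch, Finset.prod_range_one, pow_zero]
    rw [div_eq_mul_inv]
    congr 1
    · simp
    · congr 1; ring
  rw [hs.hasSum_iff_tendsto_nat, ← hval]
  simp only [hdiff, Finset.sum_range_sub']
  simpa using tendsto_const_nhds.sub hP0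

/-- Shifting -q to -q^(N+1) embeds the right-hand series in a family f(N) with f(N) - f(N+1) =
q^(N+1)/(1 + q^(N+1)) and f(N) → 0. The 1/2 is the term n = 0. -/
lemma hasSum_pow_div_one_add_pow (hq : ‖q‖ < 1) :
    HasSum (fun n : ℕ => q ^ n / (1 + q ^ n))
      (∑' n : ℕ, q ^ (n.choose 2) * (qPoch (-q) q n)⁻¹ / (1 - q ^ n) * q ^ (1 * n) + 1 / 2) := by
  obtain ⟨C, hC⟩ := exists_norm_inv_qPoch_shift_le hq
  obtain ⟨D, hD, hD'⟩ := exists_norm_inv_one_sub_pow_le hq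
  have hC0 : 0 ≤ C := (norm_nonneg _).trans (hC 0 0)
  have hg := summable_geometric_of_lt_one (norm_nonneg q) hq
  set t : ℕ → ℕ → ℂ := fun N k => q ^ (N * k + (k + 1).choose 2) *
    (qPoch (-q * q ^ N) q k)⁻¹ / (1 - q ^ k) with ht
  have hb : ∀ N k, ‖t N k‖ ≤ ‖q‖ ^ (N * k) * (C * D * ‖q‖ ^ k) := fun N k => by
    simp only [ht, div_eq_mul_inv, norm_mul, norm_pow, pow_add]
    have h1 : ‖q‖ ^ (k + 1).choose 2 ≤ ‖q‖ ^ k := by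
      refine pow_le_pow_of_le_one (norm_nonneg _) hq.le ?_
      rw [Nat.choose_succ_succ' k 1, Nat.choose_one_right]; omega
    calc _ = ‖q‖ ^ (N * k) * ((‖(qPoch (-q * q ^ N) q k)⁻¹‖ * ‖(1 - q ^ k)⁻¹‖) *
          ‖q‖ ^ (k + 1).choose 2) := by ring
      _ ≤ _ := by
        gcongr
        · exact hC N k
        · exact hD' k
  have hb1 : ∀ N k, ‖t N k‖ ≤ C * D * ‖q‖ ^ k := fun N k =>
    (hb N k).trans (mul_le_of_le_one_left (by positivity) (pow_le_one₀ (norm_nonneg _) hq.le))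
  have hs : ∀ N, Summable (t N) := fun N => .of_norm_bounded (hg.mul_left (C * D)) (hb1 N)
  have ht0 : ∀ N, t N 0 = 0 := fun N => by simp [ht]
  set f : ℕ → ℂ := fun N => ∑' k, t N k with hf
  have hf0 : Tendsto f atTop (𝓝 0) := by
    have := tendsto_tsum_of_dominated_convergence (𝓕 := (atTop : Filter ℕ)) (f := t)
      (g := fun _ => 0) (hg.mul_left (C * D)) (fun k => ?_) (.of_forall hb1)
    · simpa using this
    · rcases eq_or_ne k 0 with rfl | hk
      · simp [ht0]
      · refine squeeze_zero_norm (fun N => hb N k) ?_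
        have := (tendsto_pow_atTop_nhds_zero_of_lt_one (r := ‖q‖ ^ k) (by positivity)
          (pow_lt_one₀ (norm_nonneg _) hq hk)).mul_const (C * D * ‖q‖ ^ k)
        simpa [← pow_mul, mul_comm k] using this
  -- Over the common denominator (-q^(N+1);q)_{k+2} the numerator contains (1 + q^(N+k+2)) -
  -- q^(k+1)(1 + q^(N+1)) = 1 - q^(k+1), which cancels; `tsum_telescope_qPoch_neg` sums the rest.
  have hdiff : ∀ N, q ^ (N + 1) / (1 + q ^ (N + 1)) = f N - f (N + 1) := fun N => by
    rw [← (tsum_telescope_qPoch_neg hq N).tsum_eq, hf, ← (hs N).tsum_sub (hs (N + 1)),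
      ((hs N).sub (hs (N + 1))).tsum_eq_zero_add, ht0, ht0, sub_zero, zero_add]
    refine tsum_congr fun k => ?_
    simp only [ht]
    have h0 := one_sub_pow_ne_zero hq k.succ_ne_zero
    have h2 := one_sub_neg_mul_pow_mul_pow_ne_zero hq N (k + 1)
    have h4 := qPoch_succ (-q * q ^ N) q (k + 1)
    have h5 := qPoch_succ_left (-q * q ^ N) q (k + 1)
    rw [mul_assoc (-q), ← pow_succ] at h5
    have h6 : 1 - -q * q ^ N ≠ 0 := one_sub_neg_self_mul_pow_ne_zero hq N
    have e1 : (qPoch (-q * q ^ N) q (k + 1))⁻¹ =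
        (1 - -q * q ^ N * q ^ (k + 1)) * (qPoch (-q * q ^ N) q (k + 2))⁻¹ := by
      rw [h4, mul_inv, mul_left_comm, mul_inv_cancel₀ h2, mul_one]
    have e2 : (qPoch (-q * q ^ (N + 1)) q (k + 1))⁻¹ =
        (1 - -q * q ^ N) * (qPoch (-q * q ^ N) q (k + 2))⁻¹ := by
      rw [h5, mul_inv, mul_inv_cancel_left₀ h6]
    rw [e1, e2, ← sub_div, eq_div_iff h0, Nat.succ_eq_add_one]
    ring
  have hsum : Summable (fun n : ℕ => q ^ (n + 1) / (1 + q ^ (n + 1))) := by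
    have h : Tendsto (fun n : ℕ => (1 + q ^ (n + 1))⁻¹) atTop (𝓝 (1 + 0)⁻¹) :=
      (tendsto_const_nhds.add ((tendsto_add_atTop_iff_nat 1).2
        (tendsto_pow_atTop_nhds_zero_of_norm_lt_one hq))).inv₀ (by simp)
    obtain ⟨B, hB0, hB⟩ := h.exists_norm_le
    refine .of_norm_bounded (hg.mul_left B) fun n => ?_
    rw [div_eq_mul_inv, norm_mul, norm_pow, mul_comm]
    exact mul_le_mul (hB n) (pow_le_pow_of_le_one (norm_nonneg _) hq.le n.le_succ)
      (by positivity) hB0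
  have hf' : f 0 = ∑' n : ℕ, q ^ (n.choose 2) * (qPoch (-q) q n)⁻¹ / (1 - q ^ n) * q ^ (1 * n) := by
    refine tsum_congr fun k => ?_
    simp only [ht]
    rw [Nat.choose_succ_succ' k 1, Nat.choose_one_right, pow_zero, mul_one]
    ring
  rw [← hf', ← hasSum_nat_add_iff' 1]
  rw [hsum.hasSum_iff_tendsto_nat]
  simp only [hdiff, Finset.sum_range_sub']
  have : f 0 + 1 / 2 - ∑ i ∈ Finset.range 1, q ^ i / (1 + q ^ i) = f 0 - 0 := by
    norm_num
  rw [this]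
  exact tendsto_const_nhds.sub hf0

/-! ### Product identities and the evaluation of the q-series. -/

lemma qPoch_neg_mul_qPoch (q : ℂ) (n : ℕ) :
    qPoch (-q) q n * qPoch q q n = qPoch (q ^ 2) (q ^ 2) n := by
  simp only [qPoch, ← Finset.prod_mul_distrib]
  exact Finset.prod_congr rfl fun j _ => by ring

lemma qPoch_two_mul (q : ℂ) (n : ℕ) :
    qPoch q q (2 * n) = qPoch q (q ^ 2) n * qPoch (q ^ 2) (q ^ 2) n := by
  induction n with
  | zero => simp [qPoch]
  | succ n ih =>
    rw [show 2 * (n + 1) = 2 * n + 1 + 1 by ring, qPoch_succ, qPoch_succ, ih, qPoch_succ, qPoch_succ]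
    ring

lemma norm_sq_lt_one (hq : ‖q‖ < 1) : ‖q ^ 2‖ < 1 := by
  rw [norm_pow]; exact pow_lt_one₀ (norm_nonneg _) hq two_ne_zero

/-- Euler's identity. -/
lemma qPochInf_neg_mul_qPochInf_sq (hq : ‖q‖ < 1) :
    qPochInf (-q) q * qPochInf q (q ^ 2) = 1 := by
  have h0 := qPochInf_ne_zero hq (one_sub_self_mul_pow_ne_zero hq)
  have h1 := ((tendsto_qPoch (-q) hq).mul (tendsto_qPoch q hq)).mul
    (tendsto_qPoch q (norm_sq_lt_one hq))
  have h2 := (tendsto_qPoch q hq).comp (tendsto_id.const_mul_atTop' (two_pos : 0 < 2))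
  have h3 := tendsto_nhds_unique h1 (h2.congr fun n => ?_)
  · refine mul_right_cancel₀ h0 ?_
    linear_combination h3
  · simp only [Function.comp, id, qPoch_two_mul, qPoch_neg_mul_qPoch]
    ring

lemma qPochInf_eq_qPoch_mul (a : ℂ) (hq : ‖q‖ < 1) (n : ℕ) :
    qPochInf a q = qPoch a q n * qPochInf (a * q ^ n) q := by
  refine tendsto_nhds_unique ((tendsto_add_atTop_iff_nat n).2 (tendsto_qPoch a hq)) ?_
  refine ((tendsto_qPoch (a * q ^ n) hq).const_mul (qPoch a q n)).congr fun k => ?_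
  rw [add_comm, qPoch_add]

/-- Multiplied by (q;q)_n, the first factor becomes (q;q)_{2n+2} = (q;q²)_{n+1} (-q;q)_{n+1}
(q;q)_{n+1}, and (q;q²)_{n+1} completes the infinite product. -/
lemma qPoch_pow_mul_qPochInf (hq : ‖q‖ < 1) (n : ℕ) :
    qPoch (q ^ (n + 1)) q (n + 2) * qPochInf (q ^ (2 * (n + 1) + 1)) (q ^ 2) =
      (1 - q ^ (n + 1)) * qPoch (-q) q (n + 1) * qPochInf q (q ^ 2) := by
  have h0 := qPoch_ne_zero (one_sub_self_mul_pow_ne_zero hq) n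
  have h1 := qPochInf_eq_qPoch_mul q (norm_sq_lt_one hq) (n + 1)
  have h2 := qPoch_add q q n (n + 2)
  have h3 := qPoch_two_mul q (n + 1)
  have h4 := qPoch_neg_mul_qPoch q (n + 1)
  rw [show n + (n + 2) = 2 * (n + 1) by ring, h3, ← h4, qPoch_succ q q n, ← pow_succ'] at h2
  rw [← pow_mul, ← pow_succ'] at h1
  rw [h1]
  refine mul_left_cancel₀ h0 ?_
  linear_combination -(qPochInf (q ^ (2 * (n + 1) + 1)) (q ^ 2)) * h2

/-- The `q`-series identity. -/
lemma hasSum_pow_div_qPoch_mul_qPochInf (hq : ‖q‖ < 1) :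
    HasSum
      (fun n : ℕ => q ^ (n + 1) /
        (qPoch (q ^ (n + 1)) q (n + 2) * qPochInf (q ^ (2 * (n + 1) + 1)) (q ^ 2)))
      (-(1 / 2) * ramanujanR q +
        1 / qPochInf q (q ^ 2) * ∑' n : ℕ, q ^ n / (1 + q ^ n)) := by
  obtain ⟨B, -, hB⟩ := exists_norm_inv_qPoch_le hq (one_sub_neg_self_mul_pow_ne_zero hq)
  obtain ⟨B', hB'⟩ := exists_norm_div_one_sub_pow_le hq hB
  have hE := qPochInf_neg_mul_qPochInf_sq hq
  have hS : qPochInf (-q) q ≠ 0 := left_ne_zero_of_mul_eq_one hE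
  have h1 := (summable_mul_pow_mul hq hB' one_ne_zero).hasSum
  -- The dropped term n = 0 is 0, since its denominator 1 - q^0 vanishes.
  rw [← hasSum_nat_add_iff' 1, tsum_inv_qPoch_neg_div_one_sub_pow hq] at h1
  have h2 := h1.mul_left (qPochInf (-q) q)
  rw [eq_inv_of_mul_eq_one_right hE, (hasSum_pow_div_one_add_pow hq).tsum_eq]
  have hval : -(1 / 2) * ramanujanR q + 1 / (qPochInf (-q) q)⁻¹ *
      (∑' n : ℕ, q ^ (n.choose 2) * (qPoch (-q) q n)⁻¹ / (1 - q ^ n) * q ^ (1 * n) + 1 / 2) =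
      qPochInf (-q) q *
        (∑' n : ℕ, q ^ (n.choose 2) * (qPoch (-q) q n)⁻¹ / (1 - q ^ n) * q ^ (1 * n) + 1 / 2 -
          ramanujanR q * (qPochInf (-q) q)⁻¹ / 2 -
        ∑ i ∈ Finset.range 1, (qPoch (-q) q i)⁻¹ / (1 - q ^ i) * q ^ (1 * i)) := by
    simp only [Finset.sum_range_one, pow_zero, sub_self, div_zero, zero_mul, sub_zero, one_div,
      inv_inv]
    linear_combination (ramanujanR q / 2) * mul_inv_cancel₀ hS
  rw [hval]
  refine h2.congr_terms fun n => ?_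
  rw [qPoch_pow_mul_qPochInf hq, eq_inv_of_mul_eq_one_right hE]
  simp only [div_eq_mul_inv, mul_inv, inv_inv, one_mul]
  ring

end Lambert

/-! ### Generating functions of multisets with prescribed elements. -/

section Multiset

/-- Multisets with elements in `insert a A`, split off the copies of `a`. -/
def multisetInsertEquiv {A : Finset ℕ} {a : ℕ} (ha : a ∉ A) :
    ℕ × {s : Multiset ℕ // ∀ i ∈ s, i ∈ A} ≃ {s : Multiset ℕ // ∀ i ∈ s, i ∈ insert a A} where
  toFun x := ⟨Multiset.replicate x.1 a + x.2.1, fun i hi => by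
    rcases Multiset.mem_add.1 hi with h | h
    · rw [Multiset.eq_of_mem_replicate h]; exact Finset.mem_insert_self _ _
    · exact Finset.mem_insert_of_mem (x.2.2 i h)⟩
  invFun s := (s.1.count a, ⟨s.1.filter (· ≠ a), fun i hi => by
    rw [Multiset.mem_filter] at hi
    exact (Finset.mem_insert.1 (s.2 i hi.1)).resolve_left hi.2⟩)
  left_inv x := by
    obtain ⟨k, s, hs⟩ := x
    have h1 : a ∉ s := fun h => ha (hs a h)
    ext1
    · simp [Multiset.count_eq_zero_of_notMem h1]
    · ext1
      simp only [Multiset.filter_add]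
      rw [Multiset.filter_eq_nil.2, Multiset.filter_eq_self.2, zero_add]
      · intro b hb h; exact h1 (h ▸ hb)
      · intro b hb; simpa using Multiset.eq_of_mem_replicate hb
  right_inv s := by
    ext1
    simp only
    rw [← Multiset.filter_eq' s.1 a]
    exact Multiset.filter_add_not (· = a) s.1

lemma hasSum_multiset_of_finset {𝕜 : Type*} [RCLike 𝕜] {q : 𝕜} (hq : ‖q‖ < 1) (A : Finset ℕ) (hA : 0 ∉ A) :
    HasSum (fun s : {s : Multiset ℕ // ∀ i ∈ s, i ∈ A} => q ^ s.1.sum)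
      (∏ a ∈ A, (1 - q ^ a)⁻¹) := by
  induction A using Finset.induction_on with
  | empty =>
    have hu : ∀ s : {s : Multiset ℕ // ∀ i ∈ s, i ∈ (∅ : Finset ℕ)}, s = ⟨0, by simp⟩ := fun s =>
      Subtype.ext (Multiset.eq_zero_of_forall_notMem fun i hi => by simpa using s.2 i hi)
    have := hasSum_single (f := fun s : {s : Multiset ℕ // ∀ i ∈ s, i ∈ (∅ : Finset ℕ)} =>
      q ^ s.1.sum) ⟨0, by simp⟩ (fun s hs => absurd (hu s) hs)
    simpa using this
  | insert a A ha ih =>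
    rw [Finset.prod_insert ha]
    refine (multisetInsertEquiv ha).hasSum_iff.1 ?_
    have ha0 : a ≠ 0 := fun h => hA (h ▸ Finset.mem_insert_self _ _)
    have h1 : ‖q ^ a‖ < 1 := by rw [norm_pow]; exact pow_lt_one₀ (norm_nonneg _) hq ha0
    have hg := hasSum_geometric_of_norm_lt_one h1
    have ih := ih fun h => hA (Finset.mem_insert_of_mem h)
    have hs := summable_mul_of_summable_norm hg.summable.norm ih.summable.norm
    have := HasSum.mul hg ih hs
    refine this.congr_terms fun x => ?_
    simp [multisetInsertEquiv, pow_add, pow_mul, mul_comm]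

/-- The multisets all of whose elements lie in `A`. -/
def multisetsIn (A : Set ℕ) : Set (Multiset ℕ) := {s | ∀ i ∈ s, i ∈ A}

lemma hasSum_indicator_multisetsIn {𝕜 : Type*} [RCLike 𝕜] {q : 𝕜} (hq : ‖q‖ < 1)
    (A : Finset ℕ) (hA : 0 ∉ A) :
    HasSum ((multisetsIn A).indicator fun s => q ^ s.sum) (∏ a ∈ A, (1 - q ^ a)⁻¹) :=
  hasSum_subtype_iff_indicator.1 (hasSum_multiset_of_finset hq A hA)

lemma multisetsIn_mono {A B : Set ℕ} (h : A ⊆ B) : multisetsIn A ⊆ multisetsIn B :=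
  fun _ hs i hi => h (hs i hi)

variable {q : ℂ}

/-- Finitely many multisets of positive integers have all parts at most some K, so their partial sum
is at most the product of 1/(1 - ‖q‖^a) over 1 ≤ a ≤ K, bounded in K. -/
lemma summable_norm_pow_sum (hq : ‖q‖ < 1) :
    Summable ((multisetsIn {i | 0 < i}).indicator fun s => ‖q‖ ^ s.sum) := by
  have hr : ‖(‖q‖ : ℂ)‖ < 1 := by simpa using hq
  obtain ⟨C, -, hC⟩ := exists_norm_inv_qPoch_le hr (one_sub_self_mul_pow_ne_zero hr)
  refine summable_of_sum_le (c := C) (fun s => Set.indicator_nonneg (fun _ _ => by positivity) s)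
    fun u => ?_
  set K := u.sup Multiset.sum
  have h := hasSum_indicator_multisetsIn (𝕜 := ℝ) (q := ‖q‖) (by simpa using hq)
    ((Finset.range K).image (· + 1)) (by simp)
  have h1 : ∏ a ∈ (Finset.range K).image (· + 1), (1 - ‖q‖ ^ a)⁻¹ ≤ C := by
    refine (Real.le_norm_self _).trans (le_of_eq_of_le ?_ (hC K))
    rw [Finset.prod_image (by simp), ← Complex.norm_real]
    congr 1
    simp [qPoch, ← pow_succ']
  refine le_trans (Finset.sum_le_sum fun s hs => ?_) ((sum_le_hasSum u
    (fun s _ => Set.indicator_nonneg (fun _ _ => by positivity) s) h).trans h1)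
  by_cases hp : s ∈ multisetsIn {i | 0 < i}
  · have : s ∈ multisetsIn ((Finset.range K).image (· + 1) : Finset ℕ) := fun i hi => by
      have h0 : 0 < i := hp i hi
      have h1 : i ≤ K := (Multiset.le_sum_of_mem hi).trans (Finset.le_sup (f := Multiset.sum) hs)
      simp only [Finset.coe_image, Finset.coe_range, Set.mem_image, Set.mem_Iio]
      exact ⟨i - 1, by omega, by omega⟩
    rw [Set.indicator_of_mem hp, Set.indicator_of_mem this]
  · rw [Set.indicator_of_notMem hp]
    exact Set.indicator_nonneg (fun _ _ => by positivity) s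

lemma norm_indicator_pow_sum_le {X : Set (Multiset ℕ)} (hX : X ⊆ multisetsIn {i | 0 < i})
    (s : Multiset ℕ) : ‖X.indicator (fun s => q ^ s.sum) s‖ ≤
      (multisetsIn {i | 0 < i}).indicator (fun s => ‖q‖ ^ s.sum) s := by
  by_cases h : s ∈ X
  · rw [Set.indicator_of_mem h, Set.indicator_of_mem (hX h), norm_pow]
  · rw [Set.indicator_of_notMem h, norm_zero]
    exact Set.indicator_nonneg (fun _ _ => by positivity) s

lemma summable_indicator_pow_sum (hq : ‖q‖ < 1) {X : Set (Multiset ℕ)}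
    (hX : X ⊆ multisetsIn {i | 0 < i}) : Summable (X.indicator fun s => q ^ s.sum) :=
  .of_norm_bounded (summable_norm_pow_sum hq) (norm_indicator_pow_sum_le hX)

/-- The generating function of the multisets with elements in an increasing union of finite sets. -/
lemma hasSum_multisetsIn_of_tendsto (hq : ‖q‖ < 1) {A : ℕ → Finset ℕ} {B : Set ℕ}
    (hA : Monotone A) (hB : ∀ i, i ∈ B ↔ ∃ k, i ∈ A k) (h0 : 0 ∉ B) {z : ℂ}
    (hz : Tendsto (fun k => ∏ a ∈ A k, (1 - q ^ a)⁻¹) atTop (𝓝 z)) :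
    HasSum ((multisetsIn B).indicator fun s => q ^ s.sum) z := by
  have hsub : ∀ k, (A k : Set ℕ) ⊆ B := fun k i hi => (hB i).2 ⟨k, hi⟩
  have hpos : B ⊆ {i | 0 < i} := fun i hi => Nat.pos_of_ne_zero fun h => h0 (h ▸ hi)
  have hs := summable_indicator_pow_sum hq (multisetsIn_mono hpos)
  have ht := tendsto_tsum_of_dominated_convergence (𝓕 := (atTop : Filter ℕ))
    (f := fun k => (multisetsIn (A k)).indicator fun s => q ^ s.sum)
    (g := (multisetsIn B).indicator fun s => q ^ s.sum) (summable_norm_pow_sum hq)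
    (fun s => ?_) (.of_forall fun k =>
      norm_indicator_pow_sum_le (multisetsIn_mono ((hsub k).trans hpos)))
  · have he : ∀ k, ∑' s, (multisetsIn (A k)).indicator (fun s => q ^ s.sum) s =
        ∏ a ∈ A k, (1 - q ^ a)⁻¹ := fun k =>
      (hasSum_indicator_multisetsIn hq (A k) fun h => h0 (hsub k h)).tsum_eq
    simp only [he] at ht
    exact tendsto_nhds_unique ht hz ▸ hs.hasSum
  · by_cases h : s ∈ multisetsIn B
    · have : ∀ᶠ k in atTop, ∀ i ∈ s.toFinset, i ∈ A k := by
        rw [Filter.eventually_all_finset]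
        intro i hi
        obtain ⟨k, hk⟩ := (hB i).1 (h i (Multiset.mem_toFinset.1 hi))
        filter_upwards [eventually_ge_atTop k] with k' hk'
        exact hA hk' hk
      refine tendsto_const_nhds.congr' ?_
      filter_upwards [this] with k hk
      rw [Set.indicator_of_mem h, Set.indicator_of_mem]
      exact fun i hi => hk i (Multiset.mem_toFinset.2 hi)
    · rw [Set.indicator_of_notMem h]
      refine tendsto_const_nhds.congr fun k => ?_
      rw [Set.indicator_of_notMem fun h' => h (multisetsIn_mono (hsub k) h')]

end Multiset

/-! ### Partitions grouped by smallest part. -/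

section Partitions

/-- The admissible parts of a partition with smallest part at least `n` whose even parts are at
most `2 * n`. -/
def admissibleParts (n : ℕ) : Set ℕ := {i | n ≤ i ∧ (Even i → i ≤ 2 * n)}

/-- A finite exhaustion of `admissibleParts n`. -/
def admissiblePartsUpTo (n k : ℕ) : Finset ℕ :=
  Finset.Icc n (2 * n) ∪ (Finset.range k).image fun j => 2 * n + 1 + 2 * j

lemma monotone_admissiblePartsUpTo (n : ℕ) : Monotone (admissiblePartsUpTo n) := fun _ _ h =>
  Finset.union_subset_union_right (Finset.image_subset_image (Finset.range_subset_range.2 h))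

lemma mem_admissibleParts_iff (n i : ℕ) :
    i ∈ admissibleParts n ↔ ∃ k, i ∈ admissiblePartsUpTo n k := by
  simp only [admissibleParts, admissiblePartsUpTo, Set.mem_ofPred_eq, Finset.mem_union,
    Finset.mem_Icc, Finset.mem_image, Finset.mem_range]
  constructor
  · rintro ⟨h1, h2⟩
    by_cases h : i ≤ 2 * n
    · exact ⟨0, .inl ⟨h1, h⟩⟩
    · obtain ⟨j, hj⟩ := Nat.not_even_iff_odd.1 (mt h2 h)
      exact ⟨j - n + 1, .inr ⟨j - n, by omega, by omega⟩⟩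
  · rintro ⟨k, h | ⟨j, -, rfl⟩⟩
    · exact ⟨h.1, fun _ => h.2⟩
    · refine ⟨by omega, fun h => ?_⟩
      obtain ⟨c, hc⟩ := h
      omega

variable {q : ℂ}

lemma prod_admissiblePartsUpTo (q : ℂ) (n k : ℕ) :
    ∏ a ∈ admissiblePartsUpTo n k, (1 - q ^ a)⁻¹ =
      (qPoch (q ^ n) q (n + 1) * qPoch (q ^ (2 * n + 1)) (q ^ 2) k)⁻¹ := by
  rw [admissiblePartsUpTo, Finset.prod_union, Finset.prod_image, mul_inv, qPoch, qPoch,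
    ← Finset.prod_inv_distrib, ← Finset.prod_inv_distrib]
  · congr 1
    · rw [← Finset.Ico_succ_right_eq_Icc, Finset.prod_Ico_eq_prod_range]
      refine Finset.prod_congr (congrArg _ ?_) fun j _ => ?_
      · rw [Order.succ_eq_add_one]; omega
      rw [pow_add]
    · refine Finset.prod_congr rfl fun j _ => ?_
      rw [pow_add, pow_mul q 2 j]
  · intro a _ b _ h
    simpa using h
  · rw [Finset.disjoint_left]
    intro a ha hb
    simp only [Finset.mem_Icc, Finset.mem_image] at ha hb
    obtain ⟨j, -, rfl⟩ := hb
    omega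

lemma one_sub_pow_mul_pow_ne_zero (hq : ‖q‖ < 1) {n : ℕ} (hn : n ≠ 0) (j : ℕ) :
    1 - q ^ n * q ^ j ≠ 0 := by
  rw [← pow_add]; exact one_sub_pow_ne_zero hq (by omega)

lemma tendsto_prod_admissiblePartsUpTo (hq : ‖q‖ < 1) {n : ℕ} (hn : n ≠ 0) :
    Tendsto (fun k => ∏ a ∈ admissiblePartsUpTo n k, (1 - q ^ a)⁻¹) atTop
      (𝓝 (qPoch (q ^ n) q (n + 1) * qPochInf (q ^ (2 * n + 1)) (q ^ 2))⁻¹) := by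
  simp only [prod_admissiblePartsUpTo]
  refine ((tendsto_qPoch _ (norm_sq_lt_one hq)).const_mul _).inv₀ (mul_ne_zero ?_ ?_)
  · exact qPoch_ne_zero (one_sub_pow_mul_pow_ne_zero hq hn) _
  · refine qPochInf_ne_zero (norm_sq_lt_one hq) fun j => ?_
    rw [← pow_mul]
    exact one_sub_pow_mul_pow_ne_zero hq (by omega) _

/-- The generating function of the admissible multisets that contain the smallest possible
part `n`. -/
lemma hasSum_multisetsIn_diff (hq : ‖q‖ < 1) {n : ℕ} (hn : n ≠ 0) :
    HasSum ((multisetsIn (admissibleParts n) \ multisetsIn (admissibleParts n \ {n})).indicator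
        fun s => q ^ s.sum)
      (q ^ n / (qPoch (q ^ n) q (n + 1) * qPochInf (q ^ (2 * n + 1)) (q ^ 2))) := by
  have ht := tendsto_prod_admissiblePartsUpTo hq hn
  have h0 : 0 ∉ admissibleParts n := fun h => hn (Nat.le_zero.1 h.1)
  have h1 := hasSum_multisetsIn_of_tendsto hq (monotone_admissiblePartsUpTo n)
    (mem_admissibleParts_iff n) h0 ht
  -- Forbidding the part n multiplies the product by 1 - q^n, so the difference keeps the factor
  -- q^n.
  have h2 := hasSum_multisetsIn_of_tendsto hq (A := fun k => (admissiblePartsUpTo n k).erase n)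
    (B := admissibleParts n \ {n})
    (fun _ _ h => Finset.erase_subset_erase _ (monotone_admissiblePartsUpTo n h))
    (fun i => by
      simp only [Set.mem_sdiff, Set.mem_singleton_iff, Finset.mem_erase,
        mem_admissibleParts_iff]
      tauto) (fun h => h0 h.1) ((ht.const_mul (1 - q ^ n)).congr fun k => by
        have hmem : n ∈ admissiblePartsUpTo n k :=
          Finset.mem_union_left _ (Finset.mem_Icc.2 ⟨le_rfl, by omega⟩)
        rw [← Finset.mul_prod_erase _ _ hmem, mul_inv_cancel_left₀ (one_sub_pow_ne_zero hq hn)])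
  rw [Set.indicator_sdiff (multisetsIn_mono Set.sdiff_subset)]
  have h := h1.sub h2
  rw [← one_sub_mul, sub_sub_cancel] at h
  rw [div_eq_mul_inv]
  exact h

/-- The multisets of parts of the partitions counted by `evenPartsCount`. -/
def evenPartsMultisets : Set (Multiset ℕ) :=
  {s | ∃ n, n ≠ 0 ∧ n ∈ s ∧ ∀ i ∈ s, i ∈ admissibleParts n}

/-- `sInf` serves as a smallest-part function defined on all multisets, as grouping into fibres
requires. -/
lemma sInf_eq_of_mem {s : Multiset ℕ} {n : ℕ} (hn : n ∈ s) (h : ∀ i ∈ s, n ≤ i) :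
    sInf {i | i ∈ s} = n :=
  le_antisymm (Nat.sInf_le hn) (h _ (Nat.sInf_mem (s := {i | i ∈ s}) ⟨n, hn⟩))

lemma preimage_sInf_inter_evenPartsMultisets {n : ℕ} (hn : n ≠ 0) :
    (fun s : Multiset ℕ => sInf {i | i ∈ s}) ⁻¹' {n} ∩ evenPartsMultisets =
      multisetsIn (admissibleParts n) \ multisetsIn (admissibleParts n \ {n}) := by
  ext s
  simp only [Set.mem_inter_iff, Set.mem_preimage, Set.mem_singleton_iff, Set.mem_sdiff,
    evenPartsMultisets, multisetsIn, Set.mem_ofPred_eq]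
  constructor
  · rintro ⟨h, k, -, hk, hs⟩
    obtain rfl : k = n := (sInf_eq_of_mem hk fun i hi => (hs i hi).1).symm.trans h
    exact ⟨hs, fun h' => (h' k hk).2 rfl⟩
  · rintro ⟨hs, h⟩
    obtain ⟨i, hi'⟩ := not_forall.1 h
    obtain ⟨hi, hi'⟩ := Classical.not_imp.1 hi'
    have : i = n := by_contra fun hne => hi' ⟨hs i hi, hne⟩
    subst this
    exact ⟨sInf_eq_of_mem hi fun j hj => (hs j hj).1, i, hn, hi, hs⟩

lemma preimage_sInf_zero_inter_evenPartsMultisets :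
    (fun s : Multiset ℕ => sInf {i | i ∈ s}) ⁻¹' {0} ∩ evenPartsMultisets = ∅ := by
  refine Set.eq_empty_of_forall_notMem fun s hs => ?_
  obtain ⟨h, k, hk0, hk, hs⟩ := hs
  exact hk0 ((sInf_eq_of_mem hk fun i hi => (hs i hi).1).symm.trans h)

/-- Partitions counted by `evenPartsCount`, as multisets. -/
def evenPartsEquiv (m : ℕ) : {p : m.Partition // EvenPartsAtMostTwiceSmallest p} ≃
    ↥((fun s : Multiset ℕ => s.sum) ⁻¹' {m} ∩ evenPartsMultisets) where
  toFun p := ⟨p.1.parts, p.1.parts_sum, by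
    obtain ⟨n, ⟨hn, hle⟩, h⟩ := p.2
    exact ⟨n, (p.1.parts_pos hn).ne', hn, fun i hi => ⟨hle i hi, h i hi⟩⟩⟩
  invFun s := ⟨⟨s.1, fun {i} hi => by
    obtain ⟨-, n, hn0, hn, h⟩ := s.2
    exact (Nat.pos_of_ne_zero hn0).trans_le (h i hi).1, s.2.1⟩, by
    obtain ⟨-, n, hn0, hn, h⟩ := s.2
    exact ⟨n, ⟨hn, fun i hi => (h i hi).1⟩, fun i hi => (h i hi).2⟩⟩
  left_inv _ := rfl
  right_inv _ := rfl

lemma hasSum_evenPartsCount (hq : ‖q‖ < 1) {a : ℂ}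
    (h : HasSum (fun n : ℕ => q ^ (n + 1) /
        (qPoch (q ^ (n + 1)) q (n + 2) * qPochInf (q ^ (2 * (n + 1) + 1)) (q ^ 2))) a) :
    HasSum (fun m : ℕ => (evenPartsCount m : ℂ) * q ^ m) a := by
  have hpos : evenPartsMultisets ⊆ multisetsIn {i | 0 < i} := by
    rintro s ⟨n, hn0, -, hs⟩ i hi
    exact (Nat.pos_of_ne_zero hn0).trans_le (hs i hi).1
  have hs := (summable_indicator_pow_sum hq hpos).hasSum
  set z := ∑' s, evenPartsMultisets.indicator (fun s => q ^ s.sum) s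
  -- The same sum is grouped by smallest part, giving the q-series, and by total, giving the counts.
  have h1 := hs.tsum_fiberwise fun s : Multiset ℕ => sInf {i | i ∈ s}
  have h2 := hs.tsum_fiberwise fun s : Multiset ℕ => s.sum
  simp only [tsum_subtype _ (evenPartsMultisets.indicator _), Set.indicator_indicator] at h1 h2
  have hz : z = a := by
    rw [← hasSum_nat_add_iff' 1] at h1
    simp only [Finset.sum_range_one, preimage_sInf_zero_inter_evenPartsMultisets,
      Set.indicator_empty, tsum_zero, sub_zero] at h1
    refine (h1.congr_terms fun n => ?_).unique h
    rw [preimage_sInf_inter_evenPartsMultisets n.succ_ne_zero]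
    exact (hasSum_multisetsIn_diff hq n.succ_ne_zero).tsum_eq.symm
  rw [← hz]
  refine h2.congr_terms fun m => ?_
  rw [← tsum_subtype, evenPartsCount, Nat.card_congr (evenPartsEquiv m), ← nsmul_eq_mul,
    ← tsum_const]
  refine tsum_congr fun s => ?_
  rw [show s.1.sum = m from s.2.1]

end Partitions

/-- For every complex `q` with `‖q‖ < 1` the series `R(q)` and `∑ q^n/(1+q^n)` converge, and both
the generating function of the partitions in which each even part is at most twice the smallest
part and the `q`-series `∑_{n ≥ 1} q^n / ((q^n;q)_{n+1} (q^{2n+1};q²)_∞)` converge to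
`-R(q)/2 + (1/(q;q²)_∞) ∑_{n ≥ 0} q^n/(1+q^n)`. -/
theorem theorem3p3 (q : ℂ) (hq : ‖q‖ < 1) :
    Summable (ramanujanRTerm q) ∧
    Summable (fun n : ℕ => q ^ n / (1 + q ^ n)) ∧
    HasSum (fun m : ℕ => (evenPartsCount m : ℂ) * q ^ m)
      (-(1 / 2) * ramanujanR q +
        1 / qPochInf q (q ^ 2) * ∑' n : ℕ, q ^ n / (1 + q ^ n)) ∧
    HasSum
      (fun n : ℕ => q ^ (n + 1) /
        (qPoch (q ^ (n + 1)) q (n + 2) * qPochInf (q ^ (2 * (n + 1) + 1)) (q ^ 2)))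
      (-(1 / 2) * ramanujanR q +
        1 / qPochInf q (q ^ 2) * ∑' n : ℕ, q ^ n / (1 + q ^ n)) := by
  exact ⟨summable_ramanujanRTerm hq, (hasSum_pow_div_one_add_pow hq).summable,
    hasSum_evenPartsCount hq (hasSum_pow_div_qPoch_mul_qPochInf hq),
    hasSum_pow_div_qPoch_mul_qPochInf hq⟩
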